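/- Let $\Sigma=\{0,1\}$ and let $\mathcal B=(\Sigma^*)^{\Sigma^*}$ be the set of string functions. An oracle Turing machine $M^?$ is a deterministic multi-tape Turing machine with an oracle query tape and a query state: with oracle $\varphi\in\mathcal B$, in the query state the content $b\in\Sigma^*$ of the query tape is replaced by $\varphi(b)$ in one time step, without moving a head. For $A\subseteq\mathcal B$, the machine computes $F\colon A\to\mathcal B$ if for all $\varphi\in A$ and $a\in\Sigma^*$ it halts with oracle $\varphi$ on input $a$ and returns $F(\varphi)(a)$. Let $\mathrm{time}_{M^\varphi}(a)\in\mathbb N\cup\{\infty\}$ be the number of steps that $M^?$ takes with oracle $\varphi$ on input $a$, and let the length revision function $o_{\varphi,a}\colon\mathbb N\to\mathbb N$ assign to $n$ the maximum of $|a|$ and the lengths of all oracle answers received in the first $n$ steps of this computation. The machine runs in $A$-restricted strongly polynomial time if 1. there is $N\in\mathbb N$ such that $\#\{o_{\varphi,a}(n)\mid n\in\mathbb N\}\le N$ for all $\varphi\in A$ and $a\in\Sigma^*$, and 2. there is a polynomial $p$ with coefficients in $\mathbb N$ such that $n\le p(o_{\varphi,a}(n))$ for all $\varphi\in A$, all $a\in\Sigma^*$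 and all $n\in\mathbb N$ with $n\le\mathrm{time}_{M^\varphi}(a)$. A functional $F\colon A\to\mathcal B$ is $A$-restricted strongly polynomial-time computable, $F\in\mathrm{SP}(A)$, if it is computed by a machine that runs in $A$-restricted strongly polynomial time. A total functional $G\colon\mathcal B\to\mathcal B$ is strongly polynomial-time computable if it is $\mathcal B$-restricted strongly polynomial-time computable. Let $\mathrm{SP}|_A$ be the set of all $F\colon A\to\mathcal B$ that have a strongly polynomial-time computable extension $G\colon\mathcal B\to\mathcal B$. **Lemma.** For every $A\subseteq\mathcal B$ it holds that $\mathrm{SP}(A)=\mathrm{SP}|_A$. In particular, every $A$-restricted strongly polynomial-time computable functional has a total strongly polynomial-time computable extension. -/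

import Mathlib

/-- The set of string functions from finite binary strings to finite binary strings. -/
abbrev Baire : Type := List Bool → List Bool

namespace OracleMachine

/-- Tape symbols: the blank, the two letters of the alphabet, and auxiliary symbols. -/
inductive Sym (Γ : Type) : Type
  | blank : Sym Γ
  | bit (b : Bool) : Sym Γ
  | aux (g : Γ) : Sym Γ

/-- The letter a symbol stands for, if it is one of the two letters of the alphabet. -/
def Sym.toBit {Γ : Type} : Sym Γ → Option Bool
  | Sym.bit b => some b
  | _ => none

/-- The tapes of an oracle machine: input, output and oracle query tape, and work tapes. -/
inductive TapeName (W : Type) : Type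
  | input : TapeName W
  | output : TapeName W
  | query : TapeName W
  | work (w : W) : TapeName W

inductive Move : Type
  | left : Move
  | stay : Move
  | right : Move

/-- The new head position on a one-sided infinite tape; a move to the left in the leftmost
cell has no effect. -/
def Move.apply : Move → ℕ → ℕ
  | Move.left, n => n - 1
  | Move.stay, n => n
  | Move.right, n => n + 1

/-- The tape on which `w` is written from the leftmost cell on and that is blank otherwise. -/
def writeString {Γ : Type} (w : List Bool) : ℕ → Sym Γ :=
  fun i => (w[i]?).elim Sym.blank Sym.bit

open scoped Classical in
/-- The string on a tape: the letters from the leftmost cell up to (excluding) the first cell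
that does not hold a letter. Tapes without such a cell never occur in a computation. -/
noncomputable def readString {Γ : Type} (t : ℕ → Sym Γ) : List Bool :=
  if h : ∃ n, (t n).toBit = none then
    (List.range (Nat.find h)).filterMap fun i => (t i).toBit
  else []

end OracleMachine

/-- A deterministic multi-tape oracle Turing machine: finitely many states, finitely many
auxiliary tape symbols, finitely many work tapes, a transition function that reads the symbols
under all heads and yields the new state, the symbols to be written and the head moves.
In the state `query` the oracle is consulted and the machine goes on in the state `answer`. -/
structure OracleMachine where
  State : Type
  Aux : Type
  Work : Type
  finite_state : Finite State
  finite_aux : Finite Aux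
  finite_work : Finite Work
  start : State
  halt : State
  query : State
  answer : State
  trans : State → (OracleMachine.TapeName Work → OracleMachine.Sym Aux) →
    State × (OracleMachine.TapeName Work → OracleMachine.Sym Aux) ×
      (OracleMachine.TapeName Work → OracleMachine.Move)

namespace OracleMachine

structure Config (M : OracleMachine) where
  state : M.State
  tape : TapeName M.Work → ℕ → Sym M.Aux
  head : TapeName M.Work → ℕ

variable (M : OracleMachine)

/-- The initial configuration: the input is on the input tape, all other tapes are blank. -/
def init (a : List Bool) : M.Config where
  state := M.start
  tape := fun k => match k with
    | TapeName.input => writeString a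
    | _ => fun _ => Sym.blank
  head := fun _ => 0

/-- An oracle call: the content `b` of the query tape is replaced by `φ b`; no head moves. -/
noncomputable def queryStep (φ : Baire) (c : M.Config) : M.Config where
  state := M.answer
  tape := fun k => match k with
    | TapeName.query => writeString (φ (readString (c.tape TapeName.query)))
    | k => c.tape k
  head := c.head

/-- An application of the transition function. -/
def transStep (c : M.Config) : M.Config where
  state := (M.trans c.state fun k => c.tape k (c.head k)).1
  tape := fun k => Function.update (c.tape k) (c.head k)
    ((M.trans c.state fun k => c.tape k (c.head k)).2.1 k)
  head := fun k =>
    ((M.trans c.state fun k => c.tape k (c.head k)).2.2 k).apply (c.head k)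

open scoped Classical in
/-- One time step with oracle `φ`. A halted machine does not change its configuration. -/
noncomputable def step (φ : Baire) (c : M.Config) : M.Config :=
  if c.state = M.halt then c
  else if c.state = M.query then M.queryStep φ c
  else M.transStep c

/-- The configuration after `n` steps with oracle `φ` on input `a`. -/
noncomputable def config (φ : Baire) (a : List Bool) (n : ℕ) : M.Config :=
  (M.step φ)^[n] (M.init a)

/-- `M` with oracle `φ` halts on input `a` and returns `w`. -/
def Returns (φ : Baire) (a w : List Bool) : Prop :=
  ∃ n, (M.config φ a n).state = M.halt ∧
    readString ((M.config φ a n).tape TapeName.output) = w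

/-- The number of steps until `M` with oracle `φ` halts on input `a` (`⊤` if it diverges). -/
noncomputable def time (φ : Baire) (a : List Bool) : ℕ∞ :=
  ⨅ (n : ℕ) (_ : (M.config φ a n).state = M.halt), (n : ℕ∞)

open scoped Classical in
/-- The length revision function: the maximum of the length of the input and the lengths of
all oracle answers received in the first `n` steps. -/
noncomputable def lengthRevision (φ : Baire) (a : List Bool) : ℕ → ℕ
  | 0 => a.length
  | n + 1 =>
    if (M.config φ a n).state ≠ M.halt ∧ (M.config φ a n).state = M.query then
      max (lengthRevision φ a n)
        (φ (readString ((M.config φ a n).tape TapeName.query))).length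
    else lengthRevision φ a n

/-- `t` is a step-count for `M` that is valid for all oracles from `A`. -/
def IsStepCountOn (A : Set Baire) (t : ℕ → ℕ) : Prop :=
  ∀ φ ∈ A, ∀ a : List Bool, ∀ n : ℕ, (n : ℕ∞) ≤ M.time φ a → n ≤ t (M.lengthRevision φ a n)

/-- The number of values of the length revision functions of `M` for oracles from `A` is
bounded independently of oracle and input. -/
def HasFiniteLengthRevisionOn (A : Set Baire) : Prop :=
  ∃ N : ℕ, ∀ φ ∈ A, ∀ a : List Bool, (Set.range (M.lengthRevision φ a)).encard ≤ N

/-- `M` runs in `A`-restricted strongly polynomial time. -/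
def RunsInStronglyPolyTimeOn (A : Set Baire) : Prop :=
  M.HasFiniteLengthRevisionOn A ∧ ∃ p : Polynomial ℕ, M.IsStepCountOn A fun n => p.eval n

/-- `M` computes the functional `F` with domain `A`. -/
def Computes {A : Set Baire} (F : A → Baire) : Prop :=
  ∀ (φ : A) (a : List Bool), M.Returns φ a (F φ a)

end OracleMachine

/-- The total strongly polynomial-time computable functionals. -/
def SP : Set (Baire → Baire) :=
  {G | ∃ M : OracleMachine, (∀ (φ : Baire) (a : List Bool), M.Returns φ a (G φ a)) ∧
    M.RunsInStronglyPolyTimeOn Set.univ}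

/-- The `A`-restricted strongly polynomial-time computable functionals with domain `A`. -/
def SPRestricted (A : Set Baire) : Set (A → Baire) :=
  {F | ∃ M : OracleMachine, M.Computes F ∧ M.RunsInStronglyPolyTimeOn A}

/-- The functionals with domain `A` that have a total strongly polynomial-time computable
extension. -/
def SPExtendable (A : Set Baire) : Set (A → Baire) :=
  {F | ∃ G ∈ SP, ∀ φ : A, G φ = F φ}

/-! Let `M` compute `F` on `A`, with at most `N` length revision values and step-count `p` for
oracles from `A`. The constants `N` and `p` can be built into a supervised simulation of `M` that
never interferes for oracles from `A` but enforces both conditions for every oracle: it stops when a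
budget of revisions is exhausted or when a clock runs out. The difficulty is a clock that adapts to
the current length `o` at polynomial cost.

A unary ruler holds `r = o + 1`, and the clock has `d` digits in base `r + 1`, where `p o + 3 ≤ (o +
2) ^ d` (`exists_pow_bound`). When a revision raises the ruler to `r'`, the number `r'` is added to
every digit. Whatever was left before, the clock is then worth at least `(r' + 1) ^ d - 1`, enough
for the time allowed at the new length. Conversely, at most `N + 1` such refills happen, so digits
stay below a multiple of the ruler and only polynomially many steps get simulated. A tick is a
subtraction with borrow (`clockValue_tickDigits`) and costs time linear in the ruler.

The invariant `Tracks` records both bounds on the clock and is preserved for arbitrary oracles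
(`Tracks.step`). The lower bound shows that no forced stop occurs on `A` (`exists_tracks`); the
upper bound gives strongly polynomial time everywhere (`exists_bounded`). The extension is what the
supervised machine returns. The other inclusion is restriction of the oracle set. -/

namespace OracleMachine

/-! ### The machine with counters -/

/-- Names of the auxiliary counters of the clocked machine. -/
inductive Counter (d : ℕ) : Type
  -- `mirror` follows the query head, `back` is scratch space, `ruler` holds the current maximal
  -- length plus one, and `budget` the number of revisions still allowed.
  | mirror : Counter d
  | back : Counter d
  | ruler : Counter d
  | budget : Counter d
  | clock (i : Fin d) : Counter d

/-- A function on counters from its values. -/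
def Counter.pack {d : ℕ} {α : Type} (s b r w : α) (c : Fin d → α) : Counter d → α
  | mirror => s
  | back => b
  | ruler => r
  | budget => w
  | clock i => c i

instance (d : ℕ) : Finite (Counter d) := by
  refine Finite.of_surjective (α := Fin 4 ⊕ Fin d)
    (Sum.elim ![Counter.mirror, Counter.back, Counter.ruler, Counter.budget] Counter.clock) ?_
  rintro (_ | _ | _ | _ | i)
  exacts [⟨Sum.inl 0, rfl⟩, ⟨Sum.inl 1, rfl⟩, ⟨Sum.inl 2, rfl⟩, ⟨Sum.inl 3, rfl⟩, ⟨Sum.inr i, rfl⟩]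

/-- The phases of the clocked machine. A flag `src` tells whether the query tape (`true`) or the
input tape (`false`) is measured, a flag `rev` whether a length revision has been detected. -/
inductive Phase (Q : Type) (d L : ℕ) : Type
  | boot : Phase Q d L
  | load (k : Fin (L + 1)) : Phase Q d L
  | down : Phase Q d L
  | scan (src rev : Bool) : Phase Q d L
  | rewind (src rev : Bool) : Phase Q d L
  | restore (src : Bool) : Phase Q d L
  | tick (q : Q) : Phase Q d L
  | fill (i : Fin d) (q : Q) : Phase Q d L
  | unfill (q : Q) : Phase Q d L
  | run (q : Q) : Phase Q d L

instance (Q : Type) [Finite Q] (d L : ℕ) : Finite (Phase Q d L) := by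
  refine Finite.of_surjective
    (α := (Fin 2 ⊕ Fin (L + 1)) ⊕ ((Bool × Bool) ⊕ (Bool × Bool)) ⊕ Bool ⊕ Q ⊕ (Fin d × Q) ⊕ Q ⊕ Q)
    (Sum.elim (Sum.elim ![Phase.boot, Phase.down] Phase.load)
      (Sum.elim (Sum.elim (fun x => Phase.scan x.1 x.2) (fun x => Phase.rewind x.1 x.2))
      (Sum.elim Phase.restore (Sum.elim Phase.tick (Sum.elim (fun x => Phase.fill x.1 x.2)
      (Sum.elim Phase.unfill Phase.run)))))) ?_
  rintro (_ | k | _ | ⟨x, y⟩ | ⟨x, y⟩ | x | q | ⟨i, q⟩ | q | q)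
  exacts [⟨.inl (.inl 0), rfl⟩, ⟨.inl (.inr k), rfl⟩, ⟨.inl (.inl 1), rfl⟩,
    ⟨.inr (.inl (.inl (x, y))), rfl⟩, ⟨.inr (.inl (.inr (x, y))), rfl⟩,
    ⟨.inr (.inr (.inl x)), rfl⟩, ⟨.inr (.inr (.inr (.inl q))), rfl⟩,
    ⟨.inr (.inr (.inr (.inr (.inl (i, q))))), rfl⟩,
    ⟨.inr (.inr (.inr (.inr (.inr (.inl q))))), rfl⟩,
    ⟨.inr (.inr (.inr (.inr (.inr (.inr q))))), rfl⟩]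

/-- The tapes of a machine among those of a machine with additional work tapes. -/
def liftTape {W : Type} (K : Type) : TapeName W → TapeName (W ⊕ K)
  | .input => .input
  | .output => .output
  | .query => .query
  | .work w => .work (.inl w)

/-- Combine data on the tapes of a machine with data on additional work tapes. -/
def extendTapes {W K α : Type} (f : TapeName W → α) (g : K → α) : TapeName (W ⊕ K) → α
  | .input => f .input
  | .output => f .output
  | .query => f .query
  | .work (.inl w) => f (.work w)
  | .work (.inr k) => g k

@[simp] lemma extendTapes_liftTape {W K α : Type} (f : TapeName W → α) (g : K → α)
    (x : TapeName W) : extendTapes f g (liftTape K x) = f x := by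
  cases x <;> rfl

@[simp] lemma extendTapes_work_inr {W K α : Type} (f : TapeName W → α) (g : K → α)
    (k : K) : extendTapes f g (.work (.inr k)) = g k := rfl

/-- The content of a counter tape: a mark in the leftmost cell. The value of the counter is the
head position. -/
def counterTape (Γ : Type) : ℕ → Sym Γ := Function.update (fun _ => Sym.blank) 0 (Sym.bit true)

lemma counterTape_eq_bit_iff {Γ : Type} (n : ℕ) : counterTape Γ n = Sym.bit true ↔ n = 0 := by
  unfold counterTape
  by_cases h : n = 0
  · simp [h]
  · simp [h]

/-- The measured tape. -/
def srcTape (W : Type) (src : Bool) : TapeName W := if src then .query else .input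

/-- What the clocked machine does in one step. -/
structure Action (M : OracleMachine) (d L : ℕ) where
  next : Phase M.State d L
  write : TapeName M.Work → Sym M.Aux
  move : TapeName M.Work → Move
  count : Counter d → Move

open scoped Classical in
/-- The moves that move only one head. -/
noncomputable def moveOnly {W : Type} (x : TapeName W) (m : Move) : TapeName W → Move :=
  Function.update (fun _ => Move.stay) x m

open scoped Classical in
/-- The program of the clocked machine, depending on the phase, the symbols read on the tapes of
the simulated machine, and the set of counters with value zero. -/
noncomputable def program (M : OracleMachine) (d L : ℕ) (s : Phase M.State d L)
    (r : TapeName M.Work → Sym M.Aux) (z : Counter d → Prop) : Action M d L :=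
  match s with
  | .boot => ⟨.load (Fin.last L), r, fun _ => .stay, fun _ => .stay⟩
  | .load k =>
    if k = 0 then ⟨.scan false false, r, fun _ => .stay, fun _ => .stay⟩
    else ⟨.load ⟨k - 1, by omega⟩, r, fun _ => .stay,
      Counter.pack .stay .stay .stay .right fun _ => .stay⟩
  -- The oracle answer leaves the query head in place; it is driven to cell 0, which `mirror`
  -- detects, while `back` remembers the distance.
  | .down =>
    if z .mirror then ⟨.scan true false, r, fun _ => .stay, fun _ => .stay⟩
    else ⟨.down, r, moveOnly .query .left, Counter.pack .left .right .stay .stay fun _ => .stay⟩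
  -- A revision shows when the ruler is already 0 and a cell is left to scan. The cell ending the
  -- string is scanned too, whence the ruler is length plus one.
  | .scan src rev =>
    ⟨if (r (srcTape M.Work src)).toBit = none then .rewind src (rev || decide (z .ruler))
      else .scan src (rev || decide (z .ruler)), r, moveOnly (srcTape M.Work src) .right,
      Counter.pack .right .stay .left .stay fun _ => .stay⟩
  -- The way back adds the measured length plus one to the ruler and, after a revision, to every
  -- digit of the clock.
  | .rewind src rev =>
    if z .mirror then
      if rev ∧ z .budget then ⟨.run M.halt, r, fun _ => .stay, fun _ => .stay⟩
      else ⟨.restore src, r, fun _ => .stay,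
        Counter.pack .stay .stay .stay (if rev then .left else .stay) fun _ => .stay⟩
    else ⟨.rewind src rev, r, moveOnly (srcTape M.Work src) .left,
      Counter.pack .left .stay .right .stay fun _ => if rev then .right else .stay⟩
  | .restore src =>
    if z .back then
      ⟨.tick (if src then M.answer else M.start), r, fun _ => .stay, fun _ => .stay⟩
    else ⟨.restore src, r, moveOnly .query .right,
      Counter.pack .right .left .stay .stay fun _ => .stay⟩
  -- Subtraction of one with borrow: the lowest nonzero digit loses one; `fill` then raises all
  -- lower digits by the ruler, and `unfill` recovers the ruler from `back`.
  | .tick q =>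
    if h : ∃ i, ¬ z (.clock i) ∧ ∀ j < i, z (.clock j) then
      ⟨.fill h.choose q, r, fun _ => .stay,
        Counter.pack .stay .stay .stay .stay fun j => if j = h.choose then .left else .stay⟩
    else ⟨.run M.halt, r, fun _ => .stay, fun _ => .stay⟩
  | .fill i q =>
    if z .ruler then ⟨.unfill q, r, fun _ => .stay, fun _ => .stay⟩
    else ⟨.fill i q, r, fun _ => .stay,
      Counter.pack .stay .right .left .stay fun j => if j < i then .right else .stay⟩
  | .unfill q =>
    if z .back then ⟨.run q, r, fun _ => .stay, fun _ => .stay⟩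
    else ⟨.unfill q, r, fun _ => .stay, Counter.pack .stay .left .right .stay fun _ => .stay⟩
  | .run q =>
    ⟨.tick (M.trans q r).1, (M.trans q r).2.1, (M.trans q r).2.2,
      Counter.pack ((M.trans q r).2.2 .query) .stay .stay .stay fun _ => .stay⟩

/-- The machine that simulates `M`, stops it after `L` length revisions, and stops it when the
clock with `d` digits runs out. -/
noncomputable def clocked (M : OracleMachine) (d L : ℕ) : OracleMachine where
  State := Phase M.State d L
  Aux := M.Aux
  Work := M.Work ⊕ Counter d
  finite_state := haveI := M.finite_state; inferInstance
  finite_aux := M.finite_aux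
  finite_work := haveI := M.finite_work; inferInstance
  start := .boot
  halt := .run M.halt
  query := .run M.query
  answer := .down
  trans := fun s r =>
    let a := program M d L s (fun x => r (liftTape (Counter d) x))
      (fun k => r (.work (.inr k)) = Sym.bit true)
    (a.next, extendTapes a.write (fun k => match s with
      | .boot => Sym.bit true
      | _ => r (.work (.inr k))), extendTapes a.move a.count)

/-! ### Encoded configurations and single steps -/

variable {M : OracleMachine} {d L : ℕ}

/-- The configurations of the clocked machine after the first step. -/
def enc (s : Phase M.State d L) (T : TapeName M.Work → ℕ → Sym M.Aux) (H : TapeName M.Work → ℕ)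
    (C : Counter d → ℕ) : (M.clocked d L).Config where
  state := s
  tape := extendTapes T fun _ => counterTape M.Aux
  head := extendTapes H C

lemma clocked_trans {s : Phase M.State d L} (hs : s ≠ .boot) (r : TapeName M.Work → Sym M.Aux)
    (g : Counter d → Sym M.Aux) :
    (M.clocked d L).trans s (extendTapes r g) =
      ((program M d L s r fun k => g k = Sym.bit true).next,
        extendTapes (program M d L s r fun k => g k = Sym.bit true).write g,
        extendTapes (program M d L s r fun k => g k = Sym.bit true).move
          (program M d L s r fun k => g k = Sym.bit true).count) := by
  have h : (fun x => extendTapes r g (liftTape (Counter d) x)) = r := by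
    funext x
    rw [extendTapes_liftTape]
  simp only [clocked, h, extendTapes_work_inr]

lemma transStep_enc {s : Phase M.State d L} (hs : s ≠ .boot)
    (T : TapeName M.Work → ℕ → Sym M.Aux) (H : TapeName M.Work → ℕ) (C : Counter d → ℕ)
    (a : Action M d L) (ha : program M d L s (fun x => T x (H x)) (fun k => C k = 0) = a) :
    (M.clocked d L).transStep (enc s T H C) =
      enc a.next (fun x => Function.update (T x) (H x) (a.write x))
        (fun x => (a.move x).apply (H x)) (fun k => (a.count k).apply (C k)) := by
  have hread : (fun k => (enc s T H C).tape k ((enc s T H C).head k)) =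
      extendTapes (fun x => T x (H x)) (fun k => counterTape M.Aux (C k)) := by
    funext x
    rcases x with _ | _ | _ | _ | _ <;> rfl
  have htr : (M.clocked d L).trans (enc s T H C).state
      (fun k => (enc s T H C).tape k ((enc s T H C).head k)) = (a.next,
      extendTapes a.write (fun k => counterTape M.Aux (C k)), extendTapes a.move a.count) := by
    rw [hread]
    refine (clocked_trans hs _ _).trans ?_
    simp only [counterTape_eq_bit_iff, ha]
    rfl
  unfold transStep
  rw [htr]
  unfold enc
  congr 1
  · funext x
    rcases x with _ | _ | _ | x | k <;> try rfl
    exact Function.update_eq_self _ _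
  · funext x
    rcases x with _ | _ | _ | x | k <;> rfl

lemma step_enc {s : Phase M.State d L} (hs : s ≠ .boot) (hr : ∀ q, s ≠ .run q) (φ : Baire)
    (T : TapeName M.Work → ℕ → Sym M.Aux) (H : TapeName M.Work → ℕ) (C : Counter d → ℕ)
    (a : Action M d L) (ha : program M d L s (fun x => T x (H x)) (fun k => C k = 0) = a) :
    (M.clocked d L).step φ (enc s T H C) =
      enc a.next (fun x => Function.update (T x) (H x) (a.write x))
        (fun x => (a.move x).apply (H x)) (fun k => (a.count k).apply (C k)) := by
  rw [← transStep_enc hs T H C a ha]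
  unfold step
  rw [if_neg (show (enc s T H C).state ≠ (M.clocked d L).halt from hr _),
    if_neg (show (enc s T H C).state ≠ (M.clocked d L).query from hr _)]

/-- Steps that write nothing. -/
lemma step_enc_of_write {s : Phase M.State d L} (hs : s ≠ .boot) (hr : ∀ q, s ≠ .run q) (φ : Baire)
    (T : TapeName M.Work → ℕ → Sym M.Aux) (H : TapeName M.Work → ℕ) (C : Counter d → ℕ)
    {s' : Phase M.State d L} {m : TapeName M.Work → Move} {n : Counter d → Move}
    (ha : program M d L s (fun x => T x (H x)) (fun k => C k = 0) =
      ⟨s', fun x => T x (H x), m, n⟩) :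
    (M.clocked d L).step φ (enc s T H C) =
      enc s' T (fun x => (m x).apply (H x)) (fun k => (n k).apply (C k)) := by
  rw [step_enc hs hr φ T H C _ ha]
  simp

lemma pack_apply (s b r w : Move) (c : Fin d → Move) (s' b' r' w' : ℕ) (c' : Fin d → ℕ) :
    (fun k => (Counter.pack s b r w c k).apply (Counter.pack s' b' r' w' c' k)) =
      Counter.pack (s.apply s') (b.apply b') (r.apply r') (w.apply w')
        (fun i => (c i).apply (c' i)) := by
  funext k
  cases k <;> rfl

open scoped Classical in
lemma moveOnly_apply {W : Type} (x : TapeName W) (m : Move) (H : TapeName W → ℕ) :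
    (fun y => (moveOnly x m y).apply (H y)) = Function.update H x (m.apply (H x)) := by
  funext y
  unfold moveOnly
  by_cases h : y = x
  · subst h; simp
  · simp [h, Move.apply]

lemma boot_step (φ : Baire) (a : List Bool) :
    (M.clocked d L).step φ ((M.clocked d L).init a) =
      enc (.load (Fin.last L)) (M.init a).tape (M.init a).head (Counter.pack 0 0 0 0 0) := by
  unfold step
  rw [if_neg (by simp [init, clocked]), if_neg (by simp [init, clocked])]
  unfold transStep enc
  simp only [init, clocked, program]
  congr 1
  · funext x
    rcases x with _ | _ | _ | x | k <;> simp [extendTapes, liftTape, counterTape]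
  · funext x
    rcases x with _ | _ | _ | x | k <;> simp [extendTapes, Move.apply]
    rcases k with _ | _ | _ | _ | i <;> rfl

lemma load_zero_step (φ : Baire) (T : TapeName M.Work → ℕ → Sym M.Aux) (H : TapeName M.Work → ℕ)
    (C : Counter d → ℕ) :
    (M.clocked d L).step φ (enc (.load 0) T H C) = enc (.scan false false) T H C := by
  rw [step_enc_of_write (by simp) (by simp) φ T H C (by simp only [program, if_true]; rfl)]
  simp [Move.apply]

lemma load_succ_step (φ : Baire) (T : TapeName M.Work → ℕ → Sym M.Aux) (H : TapeName M.Work → ℕ)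
    (s b r w : ℕ) (c : Fin d → ℕ) (k : ℕ) (hk : k < L) :
    (M.clocked d L).step φ (enc (.load ⟨k + 1, by omega⟩) T H (Counter.pack s b r w c)) =
      enc (.load ⟨k, by omega⟩) T H (Counter.pack s b r (w + 1) c) := by
  rw [step_enc_of_write (by simp) (by simp) φ T H _
    (by simp only [program]; rw [if_neg (by simp [Fin.ext_iff])])]
  rw [pack_apply]
  simp [Move.apply]

lemma down_zero_step (φ : Baire) (T : TapeName M.Work → ℕ → Sym M.Aux) (H : TapeName M.Work → ℕ)
    (b r w : ℕ) (c : Fin d → ℕ) :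
    (M.clocked d L).step φ (enc .down T H (Counter.pack 0 b r w c)) =
      enc (.scan true false) T H (Counter.pack 0 b r w c) := by
  rw [step_enc_of_write (by simp) (by simp) φ T H _
    (by simp only [program]; rw [if_pos (by rfl)])]
  simp [Move.apply]

open scoped Classical in
lemma down_succ_step (φ : Baire) (T : TapeName M.Work → ℕ → Sym M.Aux) (H : TapeName M.Work → ℕ)
    (s b r w h : ℕ) (c : Fin d → ℕ) :
    (M.clocked d L).step φ (enc .down T (Function.update H .query (h + 1))
      (Counter.pack (s + 1) b r w c)) =
      enc .down T (Function.update H .query h) (Counter.pack s (b + 1) r w c) := by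
  rw [step_enc_of_write (by simp) (by simp) φ T _ _
    (by simp only [program]; rw [if_neg (by simp [Counter.pack])])]
  rw [pack_apply, moveOnly_apply]
  simp [Move.apply]

open scoped Classical in
lemma scan_step (φ : Baire) (T : TapeName M.Work → ℕ → Sym M.Aux) (H : TapeName M.Work → ℕ)
    (src rev : Bool) (s b r w h : ℕ) (c : Fin d → ℕ) :
    (M.clocked d L).step φ (enc (.scan src rev) T (Function.update H (srcTape M.Work src) h)
      (Counter.pack s b r w c)) =
      enc (if (T (srcTape M.Work src) h).toBit = none then .rewind src (rev || decide (r = 0))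
        else .scan src (rev || decide (r = 0))) T (Function.update H (srcTape M.Work src) (h + 1))
        (Counter.pack (s + 1) b (r - 1) w c) := by
  rw [step_enc_of_write (by simp) (by simp) φ T _ _ (by simp only [program]; rfl)]
  rw [pack_apply, moveOnly_apply]
  simp only [Move.apply, Function.update_self, Function.update_idem]
  congr!

open scoped Classical in
lemma rewind_succ_step (φ : Baire) (T : TapeName M.Work → ℕ → Sym M.Aux)
    (H : TapeName M.Work → ℕ) (src rev : Bool) (s b r w h : ℕ) (c : Fin d → ℕ) :
    (M.clocked d L).step φ (enc (.rewind src rev) T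
      (Function.update H (srcTape M.Work src) (h + 1)) (Counter.pack (s + 1) b r w c)) =
      enc (.rewind src rev) T (Function.update H (srcTape M.Work src) h)
        (Counter.pack s b (r + 1) w fun i => c i + if rev then 1 else 0) := by
  rw [step_enc_of_write (by simp) (by simp) φ T _ _
    (by simp only [program]; rw [if_neg (by simp [Counter.pack])])]
  rw [pack_apply, moveOnly_apply]
  cases rev <;> simp [Move.apply]

lemma rewind_halt_step (φ : Baire) (T : TapeName M.Work → ℕ → Sym M.Aux)
    (H : TapeName M.Work → ℕ) (src : Bool) (b r : ℕ) (c : Fin d → ℕ) :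
    (M.clocked d L).step φ (enc (.rewind src true) T H (Counter.pack 0 b r 0 c)) =
      enc (.run M.halt) T H (Counter.pack 0 b r 0 c) := by
  rw [step_enc_of_write (by simp) (by simp) φ T _ _
    (by unfold program; dsimp only; rw [if_pos (by rfl), if_pos ⟨rfl, rfl⟩])]
  simp [Move.apply]

lemma rewind_zero_step (φ : Baire) (T : TapeName M.Work → ℕ → Sym M.Aux)
    (H : TapeName M.Work → ℕ) (src rev : Bool) (b r w : ℕ) (c : Fin d → ℕ)
    (h : rev = true → w ≠ 0) :
    (M.clocked d L).step φ (enc (.rewind src rev) T H (Counter.pack 0 b r w c)) =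
      enc (.restore src) T H (Counter.pack 0 b r (w - if rev then 1 else 0) c) := by
  rw [step_enc_of_write (by simp) (by simp) φ T _ _
    (by simp only [program]; rw [if_pos (by rfl), if_neg (by simpa [Counter.pack] using h)])]
  rw [pack_apply]
  cases rev <;> simp [Move.apply]

lemma restore_zero_step (φ : Baire) (T : TapeName M.Work → ℕ → Sym M.Aux)
    (H : TapeName M.Work → ℕ) (src : Bool) (s r w : ℕ) (c : Fin d → ℕ) :
    (M.clocked d L).step φ (enc (.restore src) T H (Counter.pack s 0 r w c)) =
      enc (.tick (if src then M.answer else M.start)) T H (Counter.pack s 0 r w c) := by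
  rw [step_enc_of_write (by simp) (by simp) φ T _ _
    (by simp only [program]; rw [if_pos (by rfl)])]
  simp [Move.apply]

open scoped Classical in
lemma restore_succ_step (φ : Baire) (T : TapeName M.Work → ℕ → Sym M.Aux)
    (H : TapeName M.Work → ℕ) (src : Bool) (s b r w h : ℕ) (c : Fin d → ℕ) :
    (M.clocked d L).step φ (enc (.restore src) T (Function.update H .query h)
      (Counter.pack s (b + 1) r w c)) =
      enc (.restore src) T (Function.update H .query (h + 1)) (Counter.pack (s + 1) b r w c) := by
  rw [step_enc_of_write (by simp) (by simp) φ T _ _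
    (by simp only [program]; rw [if_neg (by simp [Counter.pack])])]
  rw [pack_apply, moveOnly_apply]
  simp [Move.apply]

lemma tick_halt_step (φ : Baire) (T : TapeName M.Work → ℕ → Sym M.Aux)
    (H : TapeName M.Work → ℕ) (q : M.State) (s b r w : ℕ) (c : Fin d → ℕ) (hc : ∀ i, c i = 0) :
    (M.clocked d L).step φ (enc (.tick q) T H (Counter.pack s b r w c)) =
      enc (.run M.halt) T H (Counter.pack s b r w c) := by
  rw [step_enc_of_write (by simp) (by simp) φ T _ _
    (by simp only [program]; rw [dif_neg (by simp [Counter.pack, hc])])]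
  simp [Move.apply]

open scoped Classical in
lemma tick_step (φ : Baire) (T : TapeName M.Work → ℕ → Sym M.Aux)
    (H : TapeName M.Work → ℕ) (q : M.State) (s b r w : ℕ) (c : Fin d → ℕ) (hc : ∃ i, c i ≠ 0) :
    ∃ i, c i ≠ 0 ∧ (∀ j < i, c j = 0) ∧
      (M.clocked d L).step φ (enc (.tick q) T H (Counter.pack s b r w c)) =
      enc (.fill i q) T H (Counter.pack s b r w (Function.update c i (c i - 1))) := by
  have h : ∃ i, ¬ (Counter.pack s b r w c (.clock i) = 0) ∧
      ∀ j < i, Counter.pack s b r w c (.clock j) = 0 := by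
    have hne : (Finset.univ.filter fun i => c i ≠ 0).Nonempty := by
      obtain ⟨i, hi⟩ := hc
      exact ⟨i, by simpa using hi⟩
    refine ⟨Finset.min' _ hne, (Finset.mem_filter.mp (Finset.min'_mem _ hne)).2, fun j hj => ?_⟩
    change c j = 0
    by_contra hj0
    exact absurd (Finset.min'_le _ j (by simpa using hj0)) (not_le.mpr hj)
  -- The witness has to be the very index chosen in `program`, not the minimum just constructed.
  refine ⟨h.choose, h.choose_spec.1, h.choose_spec.2, ?_⟩
  rw [step_enc_of_write (by simp) (by simp) φ T _ _
    (by simp only [program]; rw [dif_pos h])]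
  rw [pack_apply]
  simp only [Move.apply]
  congr 2
  funext j
  by_cases hj : j = h.choose
  · subst hj; simp
  · simp [hj]

lemma fill_zero_step (φ : Baire) (T : TapeName M.Work → ℕ → Sym M.Aux)
    (H : TapeName M.Work → ℕ) (i : Fin d) (q : M.State) (s b w : ℕ) (c : Fin d → ℕ) :
    (M.clocked d L).step φ (enc (.fill i q) T H (Counter.pack s b 0 w c)) =
      enc (.unfill q) T H (Counter.pack s b 0 w c) := by
  rw [step_enc_of_write (by simp) (by simp) φ T _ _
    (by simp only [program]; rw [if_pos (by rfl)])]
  simp [Move.apply]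

lemma fill_succ_step (φ : Baire) (T : TapeName M.Work → ℕ → Sym M.Aux)
    (H : TapeName M.Work → ℕ) (i : Fin d) (q : M.State) (s b r w : ℕ) (c : Fin d → ℕ) :
    (M.clocked d L).step φ (enc (.fill i q) T H (Counter.pack s b (r + 1) w c)) =
      enc (.fill i q) T H (Counter.pack s (b + 1) r w fun j => c j + if j < i then 1 else 0) := by
  rw [step_enc_of_write (by simp) (by simp) φ T _ _
    (by simp only [program]; rw [if_neg (by simp [Counter.pack])])]
  rw [pack_apply]
  simp only [Move.apply]
  congr 2
  funext j
  by_cases hj : j < i <;> simp [hj]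

lemma unfill_zero_step (φ : Baire) (T : TapeName M.Work → ℕ → Sym M.Aux)
    (H : TapeName M.Work → ℕ) (q : M.State) (s r w : ℕ) (c : Fin d → ℕ) :
    (M.clocked d L).step φ (enc (.unfill q) T H (Counter.pack s 0 r w c)) =
      enc (.run q) T H (Counter.pack s 0 r w c) := by
  rw [step_enc_of_write (by simp) (by simp) φ T _ _
    (by simp only [program]; rw [if_pos (by rfl)])]
  simp [Move.apply]

lemma unfill_succ_step (φ : Baire) (T : TapeName M.Work → ℕ → Sym M.Aux)
    (H : TapeName M.Work → ℕ) (q : M.State) (s b r w : ℕ) (c : Fin d → ℕ) :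
    (M.clocked d L).step φ (enc (.unfill q) T H (Counter.pack s (b + 1) r w c)) =
      enc (.unfill q) T H (Counter.pack s b (r + 1) w c) := by
  rw [step_enc_of_write (by simp) (by simp) φ T _ _
    (by simp only [program]; rw [if_neg (by simp [Counter.pack])])]
  rw [pack_apply]
  simp [Move.apply]

lemma run_step (φ : Baire) (x : M.Config) (hh : x.state ≠ M.halt) (hq : x.state ≠ M.query)
    (b r w : ℕ) (c : Fin d → ℕ) :
    (M.clocked d L).step φ (enc (.run x.state) x.tape x.head
      (Counter.pack (x.head .query) b r w c)) =
      enc (.tick (M.step φ x).state) (M.step φ x).tape (M.step φ x).head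
        (Counter.pack ((M.step φ x).head .query) b r w c) := by
  unfold step
  rw [if_neg hh, if_neg hq, if_neg (by simpa [enc, clocked] using hh),
    if_neg (by simpa [enc, clocked] using hq), transStep_enc (by simp) _ _ _ _ rfl]
  simp only [program, pack_apply]
  rfl

lemma run_query_step (φ : Baire) (x : M.Config) (hh : x.state ≠ M.halt) (hq : x.state = M.query)
    (C : Counter d → ℕ) :
    (M.clocked d L).step φ (enc (.run x.state) x.tape x.head C) =
      enc .down (M.step φ x).tape x.head C := by
  unfold step
  rw [if_neg hh, if_pos hq, if_neg (by simpa [enc, clocked] using hh),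
    if_pos (by simpa [enc, clocked] using hq)]
  unfold queryStep enc
  congr 1
  funext k
  rcases k with _ | _ | _ | _ | _ <;> rfl

/-! ### Runs without oracle calls -/

/-- `M` goes from `x` to `y` in `n` steps without consulting the oracle. -/
def Silent (M : OracleMachine) (φ : Baire) (n : ℕ) (x y : M.Config) : Prop :=
  (M.step φ)^[n] x = y ∧ ∀ j < n, ((M.step φ)^[j] x).state ≠ M.query

namespace Silent

variable {φ : Baire}

lemma refl (x : M.Config) : M.Silent φ 0 x x := ⟨rfl, by simp⟩

lemma cons {n : ℕ} {x y z : M.Config} (hq : x.state ≠ M.query) (h : M.step φ x = y)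
    (hyz : M.Silent φ n y z) : M.Silent φ (n + 1) x z := by
  refine ⟨by rw [Function.iterate_succ_apply, h, hyz.1], fun j hj => ?_⟩
  cases j with
  | zero => exact hq
  | succ j =>
    rw [Function.iterate_succ_apply, h]
    exact hyz.2 j (by omega)

lemma single {x y : M.Config} (hq : x.state ≠ M.query) (h : M.step φ x = y) :
    M.Silent φ 1 x y := cons hq h (refl y)

lemma trans {m n : ℕ} {x y z : M.Config} (hxy : M.Silent φ m x y) (hyz : M.Silent φ n y z) :
    M.Silent φ (m + n) x z := by
  refine ⟨by rw [add_comm, Function.iterate_add_apply, hxy.1, hyz.1], fun j hj => ?_⟩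
  by_cases h : j < m
  · exact hxy.2 j h
  · obtain ⟨i, rfl⟩ := Nat.exists_eq_add_of_le (not_lt.mp h)
    rw [add_comm, Function.iterate_add_apply, hxy.1]
    exact hyz.2 i (by omega)

lemma of_seq {n : ℕ} (f : ℕ → M.Config) (hq : ∀ i < n, (f i).state ≠ M.query)
    (h : ∀ i < n, M.step φ (f i) = f (i + 1)) : M.Silent φ n (f 0) (f n) := by
  induction n with
  | zero => exact refl _
  | succ n ih =>
    exact (ih (fun i hi => hq i (by omega)) fun i hi => h i (by omega)).trans
      (single (hq n (by omega)) (h n (by omega)))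

lemma config_add {n t : ℕ} {a : List Bool} {y : M.Config}
    (h : M.Silent φ n (M.config φ a t) y) : M.config φ a (t + n) = y := by
  rw [← h.1]
  unfold config
  rw [add_comm, Function.iterate_add_apply]

/-- Only oracle calls change the length revision function, so all bookkeeping of the clocked machine
is invisible to it. -/
lemma lengthRevision_add {n t : ℕ} {a : List Bool} {y : M.Config}
    (h : M.Silent φ n (M.config φ a t) y) (j : ℕ) (hj : j ≤ n) :
    M.lengthRevision φ a (t + j) = M.lengthRevision φ a t := by
  induction j with
  | zero => rfl
  | succ j ih =>
    rw [← ih (by omega)]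
    have hs := h.2 j (by omega)
    have hc : M.config φ a (t + j) = (M.step φ)^[j] (M.config φ a t) := by
      unfold config
      rw [add_comm, Function.iterate_add_apply]
    rw [← hc] at hs
    rw [← add_assoc, lengthRevision, if_neg fun h' => hs h'.2]

end Silent

/-! ### The loops of the clocked machine -/

variable {φ : Baire}

lemma enc_state_ne_query {s : Phase M.State d L} (hs : ∀ q, s ≠ .run q)
    (T : TapeName M.Work → ℕ → Sym M.Aux) (H : TapeName M.Work → ℕ) (C : Counter d → ℕ) :
    (enc s T H C).state ≠ (M.clocked d L).query := hs _

lemma load_loop (T : TapeName M.Work → ℕ → Sym M.Aux) (H : TapeName M.Work → ℕ)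
    (s b r : ℕ) (c : Fin d → ℕ) (k : ℕ) (hk : k ≤ L) : ∀ w,
    (M.clocked d L).Silent φ k (enc (.load ⟨k, by omega⟩) T H (Counter.pack s b r w c))
      (enc (.load 0) T H (Counter.pack s b r (w + k) c)) := by
  induction k with
  | zero => exact fun w => Silent.refl _
  | succ k ih =>
    intro w
    refine .cons (enc_state_ne_query (by simp) _ _ _) (load_succ_step φ T H s b r w c k hk) ?_
    convert ih (by omega) (w + 1) using 3
    omega

open scoped Classical in
lemma down_loop (T : TapeName M.Work → ℕ → Sym M.Aux) (H : TapeName M.Work → ℕ)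
    (r w : ℕ) (c : Fin d → ℕ) (n : ℕ) : ∀ b,
    (M.clocked d L).Silent φ n
      (enc .down T (Function.update H .query n) (Counter.pack n b r w c))
      (enc .down T (Function.update H .query 0) (Counter.pack 0 (b + n) r w c)) := by
  induction n with
  | zero => exact fun b => Silent.refl _
  | succ n ih =>
    intro b
    refine .cons (enc_state_ne_query (by simp) _ _ _) (down_succ_step φ T H n b r w n c) ?_
    convert ih (b + 1) using 3
    omega

open scoped Classical in
lemma restore_loop (T : TapeName M.Work → ℕ → Sym M.Aux) (H : TapeName M.Work → ℕ) (src : Bool)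
    (r w : ℕ) (c : Fin d → ℕ) (n : ℕ) : ∀ s h,
    (M.clocked d L).Silent φ n
      (enc (.restore src) T (Function.update H .query h) (Counter.pack s n r w c))
      (enc (.restore src) T (Function.update H .query (h + n)) (Counter.pack (s + n) 0 r w c)) := by
  induction n with
  | zero => exact fun s h => Silent.refl _
  | succ n ih =>
    intro s h
    refine .cons (enc_state_ne_query (by simp) _ _ _) (restore_succ_step φ T H src s n r w h c) ?_
    rw [show h + (n + 1) = h + 1 + n by omega, show s + (n + 1) = s + 1 + n by omega]
    exact ih (s + 1) (h + 1)

lemma fill_loop (T : TapeName M.Work → ℕ → Sym M.Aux) (H : TapeName M.Work → ℕ) (i : Fin d)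
    (q : M.State) (s w n : ℕ) : ∀ b (c : Fin d → ℕ),
    (M.clocked d L).Silent φ n
      (enc (.fill i q) T H (Counter.pack s b n w c))
      (enc (.fill i q) T H
        (Counter.pack s (b + n) 0 w fun j => c j + if j < i then n else 0)) := by
  induction n with
  | zero => exact fun b c => by simpa using Silent.refl _
  | succ n ih =>
    intro b c
    refine .cons (enc_state_ne_query (by simp) _ _ _) (fill_succ_step φ T H i q s b n w c) ?_
    convert ih (b + 1) _ using 3
    · omega
    · funext j
      split_ifs <;> omega

lemma unfill_loop (T : TapeName M.Work → ℕ → Sym M.Aux) (H : TapeName M.Work → ℕ)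
    (q : M.State) (s w n : ℕ) (c : Fin d → ℕ) : ∀ r,
    (M.clocked d L).Silent φ n (enc (.unfill q) T H (Counter.pack s n r w c))
      (enc (.unfill q) T H (Counter.pack s 0 (r + n) w c)) := by
  induction n with
  | zero => exact fun r => Silent.refl _
  | succ n ih =>
    intro r
    refine .cons (enc_state_ne_query (by simp) _ _ _) (unfill_succ_step φ T H q s n r w c) ?_
    convert ih (r + 1) using 3
    omega

open scoped Classical in
lemma rewind_loop (T : TapeName M.Work → ℕ → Sym M.Aux) (H : TapeName M.Work → ℕ)
    (src rev : Bool) (b w n : ℕ) : ∀ r (c : Fin d → ℕ),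
    (M.clocked d L).Silent φ n
      (enc (.rewind src rev) T (Function.update H (srcTape M.Work src) n) (Counter.pack n b r w c))
      (enc (.rewind src rev) T (Function.update H (srcTape M.Work src) 0)
        (Counter.pack 0 b (r + n) w fun i => c i + if rev then n else 0)) := by
  induction n with
  | zero => exact fun r c => by simpa using Silent.refl _
  | succ n ih =>
    intro r c
    refine .cons (enc_state_ne_query (by simp) _ _ _)
      (rewind_succ_step φ T H src rev n b r w n c) ?_
    convert ih (r + 1) _ using 3
    · omega
    · funext j
      split_ifs <;> omega

lemma writeString_toBit_eq_none_iff {Γ : Type} (v : List Bool) (i : ℕ) :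
    (writeString (Γ := Γ) v i).toBit = none ↔ v.length ≤ i := by
  unfold writeString
  by_cases h : i < v.length
  · simp [h, Sym.toBit]
  · simp [not_lt.mp h, Sym.toBit]

open scoped Classical in
lemma scan_loop (T : TapeName M.Work → ℕ → Sym M.Aux) (H : TapeName M.Work → ℕ)
    (src : Bool) (v : List Bool) (hv : T (srcTape M.Work src) = writeString v)
    (b r w : ℕ) (c : Fin d → ℕ) :
    (M.clocked d L).Silent φ (v.length + 1)
      (enc (.scan src false) T (Function.update H (srcTape M.Work src) 0) (Counter.pack 0 b r w c))
      (enc (.rewind src (decide (r < v.length + 1))) T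
        (Function.update H (srcTape M.Work src) (v.length + 1))
        (Counter.pack (v.length + 1) b (r - (v.length + 1)) w c)) := by
  -- Closed form of the configuration after `i` steps; truncated `r - i` is the ruler stopped at its
  -- left end.
  let f : ℕ → (M.clocked d L).Config := fun i =>
    enc (if i ≤ v.length then .scan src (decide (r < i)) else .rewind src (decide (r < i))) T
      (Function.update H (srcTape M.Work src) i) (Counter.pack i b (r - i) w c)
  have hf : ∀ i < v.length + 1, f i = enc (.scan src (decide (r < i))) T
      (Function.update H (srcTape M.Work src) i) (Counter.pack i b (r - i) w c) := by
    intro i hi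
    simp only [f]
    rw [if_pos (by omega)]
  have key := Silent.of_seq (M := M.clocked d L) (φ := φ) (n := v.length + 1) f ?_ ?_
  · rw [hf 0 (by omega)] at key
    simpa [f] using key
  · intro i hi
    rw [hf i hi]
    exact enc_state_ne_query (by simp) _ _ _
  · intro i hi
    rw [hf i hi, scan_step, hv]
    have hd : (decide (r < i) || decide (r - i = 0)) = decide (r < i + 1) := by
      rw [← Bool.decide_or, decide_eq_decide]
      omega
    rw [hd]
    simp only [f, writeString_toBit_eq_none_iff, Nat.sub_sub]
    by_cases h : v.length ≤ i
    · rw [if_pos h, if_neg (by omega)]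
    · rw [if_neg h, if_pos (by omega)]

/-! ### Measuring a string -/

open scoped Classical in
-- The ruler goes down by the length plus one, stopping at 0, and up again by the same amount;
-- truncated subtraction turns this into a maximum.
lemma measure_aux (T : TapeName M.Work → ℕ → Sym M.Aux) (H : TapeName M.Work → ℕ)
    (src : Bool) (v : List Bool) (hv : T (srcTape M.Work src) = writeString v)
    (b r w : ℕ) (c : Fin d → ℕ) :
    (M.clocked d L).Silent φ (2 * (v.length + 1))
      (enc (.scan src false) T (Function.update H (srcTape M.Work src) 0) (Counter.pack 0 b r w c))
      (enc (.rewind src (decide (r < v.length + 1))) T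
        (Function.update H (srcTape M.Work src) 0) (Counter.pack 0 b (max r (v.length + 1)) w
          fun i => c i + if r < v.length + 1 then v.length + 1 else 0)) := by
  have h := (scan_loop (φ := φ) (L := L) T H src v hv b r w c).trans
    (rewind_loop T H src (decide (r < v.length + 1)) b w (v.length + 1) _ c)
  convert h using 1
  · omega
  · congr 2
    · omega
    · simp

open scoped Classical in
lemma measure_halt (T : TapeName M.Work → ℕ → Sym M.Aux) (H : TapeName M.Work → ℕ)
    (src : Bool) (v : List Bool) (hv : T (srcTape M.Work src) = writeString v)
    (b r : ℕ) (c : Fin d → ℕ) (hr : r < v.length + 1) :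
    ∃ y, y.state = (M.clocked d L).halt ∧ (M.clocked d L).Silent φ (2 * (v.length + 1) + 1)
      (enc (.scan src false) T (Function.update H (srcTape M.Work src) 0)
        (Counter.pack 0 b r 0 c)) y := by
  have h := measure_aux (φ := φ) (L := L) T H src v hv b r 0 c
  rw [decide_eq_true hr] at h
  exact ⟨_, rfl, h.trans (.single (enc_state_ne_query (by simp) _ _ _)
    (rewind_halt_step φ T _ src b _ _))⟩

open scoped Classical in
lemma measure (T : TapeName M.Work → ℕ → Sym M.Aux) (H : TapeName M.Work → ℕ)
    (src : Bool) (v : List Bool) (hv : T (srcTape M.Work src) = writeString v)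
    (b r w : ℕ) (c : Fin d → ℕ) (hw : r < v.length + 1 → w ≠ 0) :
    (M.clocked d L).Silent φ (2 * (v.length + 1) + 1)
      (enc (.scan src false) T (Function.update H (srcTape M.Work src) 0) (Counter.pack 0 b r w c))
      (enc (.restore src) T (Function.update H (srcTape M.Work src) 0)
        (Counter.pack 0 b (max r (v.length + 1)) (w - if r < v.length + 1 then 1 else 0)
          fun i => c i + if r < v.length + 1 then v.length + 1 else 0)) := by
  refine (measure_aux T H src v hv b r w c).trans
    (.single (enc_state_ne_query (by simp) _ _ _) ?_)
  rw [rewind_zero_step _ _ _ _ _ _ _ _ _ (by simpa using hw)]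
  simp

/-! ### The clock -/

/-- The value of a clock with digits `c` in base `r + 1`. -/
def clockValue {d : ℕ} (r : ℕ) (c : Fin d → ℕ) : ℕ := ∑ i, c i * (r + 1) ^ (i : ℕ)

lemma clockValue_succ {d : ℕ} (r : ℕ) (c : Fin (d + 1) → ℕ) :
    clockValue r c = c 0 + (r + 1) * clockValue r (fun i => c i.succ) := by
  unfold clockValue
  rw [Fin.sum_univ_succ, Finset.mul_sum]
  simp only [Fin.val_zero, pow_zero, mul_one, Fin.val_succ]
  congr 1
  refine Finset.sum_congr rfl fun i _ => ?_
  ring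

lemma clockValue_const_add_one (d r : ℕ) :
    clockValue r (fun _ : Fin d => r) + 1 = (r + 1) ^ d := by
  induction d with
  | zero => simp [clockValue]
  | succ d ih =>
    rw [clockValue_succ, pow_succ, ← ih]
    ring

lemma clockValue_mono {d : ℕ} (r : ℕ) {c c' : Fin d → ℕ} (h : ∀ i, c i ≤ c' i) :
    clockValue r c ≤ clockValue r c' :=
  Finset.sum_le_sum fun i _ => Nat.mul_le_mul_right _ (h i)

lemma clockValue_mul {d : ℕ} (r n : ℕ) (c : Fin d → ℕ) :
    clockValue r (fun i => n * c i) = n * clockValue r c := by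
  unfold clockValue
  rw [Finset.mul_sum]
  exact Finset.sum_congr rfl fun i _ => by ring

lemma clockValue_eq_zero {d : ℕ} (r : ℕ) {c : Fin d → ℕ} (h : ∀ i, c i = 0) :
    clockValue r c = 0 := by
  simp [clockValue, h]

/-- The digits of the clock after a tick. -/
def tickDigits {d : ℕ} (r : ℕ) (i : Fin d) (c : Fin d → ℕ) : Fin d → ℕ :=
  fun j => Function.update c i (c i - 1) j + if j < i then r else 0

/-- This is `(r + 1) ^ i = 1 + ∑ j < i, r * (r + 1) ^ j`. Only the digits below `i` must vanish;
digits may exceed the base, as they do after a refill. -/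
lemma clockValue_tickDigits {d : ℕ} (r : ℕ) (i : Fin d) (c : Fin d → ℕ) (hi : c i ≠ 0)
    (hj : ∀ j < i, c j = 0) : clockValue r (tickDigits r i c) + 1 = clockValue r c := by
  induction d with
  | zero => exact i.elim0
  | succ d ih =>
    rw [clockValue_succ, clockValue_succ]
    cases i using Fin.cases with
    | zero =>
      simp only [tickDigits, Fin.not_lt_zero, if_false, Function.update_self, add_zero,
        Function.update_of_ne (Fin.succ_ne_zero _)]
      omega
    | succ i =>
      have h := ih i (fun j => c j.succ) hi fun j hji => hj _ (Fin.succ_lt_succ_iff.mpr hji)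
      have ht : (fun j : Fin d => tickDigits r i.succ c j.succ) =
          tickDigits r i (fun j => c j.succ) := by
        funext j
        simp only [tickDigits, Fin.succ_lt_succ_iff]
        by_cases hji : j = i
        · subst hji; simp
        · rw [Function.update_of_ne hji, Function.update_of_ne (by simpa using hji)]
      rw [ht, ← h, hj 0 (Fin.succ_pos i)]
      have h0 : tickDigits r i.succ c 0 = r := by
        simp [tickDigits, Function.update_of_ne (Fin.succ_ne_zero i).symm, hj 0 (Fin.succ_pos i)]
      rw [h0]
      ring

lemma tickDigits_le {d : ℕ} (r : ℕ) (i : Fin d) (c : Fin d → ℕ) (hj : ∀ j < i, c j = 0)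
    (j : Fin d) : tickDigits r i c j ≤ max (c j) r := by
  unfold tickDigits
  by_cases hji : j = i
  · subst hji; simp
  · rw [Function.update_of_ne hji]
    split_ifs with h
    · rw [hj j h]; omega
    · omega

lemma tick_loop (T : TapeName M.Work → ℕ → Sym M.Aux) (H : TapeName M.Work → ℕ)
    (q : M.State) (s r w : ℕ) (c : Fin d → ℕ) (hc : ∃ i, c i ≠ 0) :
    ∃ c', clockValue r c' + 1 = clockValue r c ∧ (∀ i, c' i ≤ max (c i) r) ∧
      (M.clocked d L).Silent φ (2 * r + 3) (enc (.tick q) T H (Counter.pack s 0 r w c))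
        (enc (.run q) T H (Counter.pack s 0 r w c')) := by
  classical
  obtain ⟨i, hi, hj, hstep⟩ := tick_step (L := L) φ T H q s 0 r w c hc
  refine ⟨tickDigits r i c, clockValue_tickDigits r i c hi hj, tickDigits_le r i c hj, ?_⟩
  have h1 := (Silent.single (enc_state_ne_query (by simp) _ _ _) hstep).trans
    (fill_loop T H i q s w r 0 _)
  have h2 := (h1.trans (.single (enc_state_ne_query (by simp) _ _ _)
    (fill_zero_step φ T H i q s _ w _))).trans
    (unfill_loop T H q s w (0 + r) _ 0)
  have h3 := h2.trans (.single (enc_state_ne_query (by simp) _ _ _)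
    (unfill_zero_step φ T H q s _ w _))
  convert h3 using 1
  · omega
  · congr 2
    · omega

/-! ### Simulation of one step -/

lemma tick_outcome (T : TapeName M.Work → ℕ → Sym M.Aux) (H : TapeName M.Work → ℕ)
    (q : M.State) (s r w : ℕ) (c : Fin d → ℕ) :
    ∃ n ≤ 2 * r + 3, ∃ y,
      (M.clocked d L).Silent φ n (enc (.tick q) T H (Counter.pack s 0 r w c)) y ∧
      ((y.state = (M.clocked d L).halt ∧ ∀ i, c i = 0) ∨
        ∃ c', clockValue r c' + 1 = clockValue r c ∧ (∀ i, c' i ≤ max (c i) r) ∧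
          y = enc (.run q) T H (Counter.pack s 0 r w c')) := by
  by_cases hc : ∃ i, c i ≠ 0
  · obtain ⟨c', h1, h2, h3⟩ := tick_loop (L := L) (φ := φ) T H q s r w c hc
    exact ⟨_, le_rfl, _, h3, .inr ⟨c', h1, h2, rfl⟩⟩
  · push Not at hc
    exact ⟨1, by omega, _, .single (enc_state_ne_query (by simp) _ _ _)
      (tick_halt_step φ T H q s 0 r w c hc), .inl ⟨rfl, hc⟩⟩

open scoped Classical in
-- `r` and `r'` are the ruler before and after the step. The simulation can stop for two reasons
-- only: a revision without budget, or an empty clock. A new state, even the halting one, is entered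
-- only after a tick.
lemma run_outcome (x : M.Config) (hh : x.state ≠ M.halt) (r r' w : ℕ) (c : Fin d → ℕ)
    (hr' : r' = if x.state = M.query then
      max r ((φ (readString (x.tape .query))).length + 1) else r) :
    ∃ n ≤ 2 * x.head .query + 4 * r' + 11, ∃ y,
      (M.clocked d L).Silent φ n ((M.clocked d L).step φ (enc (.run x.state) x.tape x.head
        (Counter.pack (x.head .query) 0 r w c))) y ∧
      ((y.state = (M.clocked d L).halt ∧ ((r < r' ∧ w = 0) ∨
          ∀ i, (c i + if r < r' then r' else 0) = 0)) ∨
        (r < r' → w ≠ 0) ∧ ∃ c', clockValue r' c' + 1 =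
            clockValue r' (fun i => c i + if r < r' then r' else 0) ∧
          (∀ i, c' i ≤ max (c i + if r < r' then r' else 0) r') ∧
          y = enc (.run (M.step φ x).state) (M.step φ x).tape (M.step φ x).head
            (Counter.pack ((M.step φ x).head .query) 0 r' (w - if r < r' then 1 else 0) c')) := by
  by_cases hq : x.state = M.query
  · rw [if_pos hq] at hr'
    generalize hv : φ (readString (x.tape .query)) = v at hr'
    have hy : M.step φ x = M.queryStep φ x := by
      unfold step
      rw [if_neg hh, if_pos hq]
    have hT : (M.step φ x).tape (srcTape M.Work true) = writeString v := by
      rw [hy, ← hv]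
      rfl
    have hH : (M.step φ x).head = x.head := by
      rw [hy]
      rfl
    have hS : (M.step φ x).state = M.answer := by
      rw [hy]
      rfl
    rw [run_query_step φ x hh hq]
    have h1 := down_loop (φ := φ) (L := L) (M.step φ x).tape x.head r w c (x.head .query) 0
    rw [Function.update_eq_self] at h1
    have h2 := h1.trans (.single (enc_state_ne_query (by simp) _ _ _)
      (down_zero_step φ (M.step φ x).tape _ _ r w c))
    have hlt : r < r' ↔ r < v.length + 1 := by omega
    by_cases hw : r < r' ∧ w = 0
    · obtain ⟨hw1, rfl⟩ := hw
      obtain ⟨y, hy1, hy2⟩ := measure_halt (φ := φ) (L := L) (M.step φ x).tape x.head true v hT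
        (0 + x.head .query) r c (hlt.mp hw1)
      exact ⟨_, by omega, y, h2.trans hy2, .inl ⟨hy1, .inl ⟨hw1, rfl⟩⟩⟩
    · have hw' : r < r' → w ≠ 0 := fun h h' => hw ⟨h, h'⟩
      have h3 := h2.trans (measure (φ := φ) (L := L) (M.step φ x).tape x.head true v hT
        (0 + x.head .query) r w c fun h => hw' (hlt.mpr h))
      rw [← hr'] at h3
      have hd : (fun i => c i + if r < v.length + 1 then v.length + 1 else 0) =
          fun i => c i + if r < r' then r' else 0 := by
        funext i
        split_ifs <;> omega
      have hd' : (w - if r < v.length + 1 then 1 else 0) = w - if r < r' then 1 else 0 := by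
        split_ifs <;> omega
      rw [hd, hd', zero_add] at h3
      have h4 := h3.trans (restore_loop (φ := φ) (L := L) (M.step φ x).tape x.head true r' _ _
        (x.head .query) 0 0)
      rw [zero_add, Function.update_eq_self] at h4
      have h5 := h4.trans (.single (enc_state_ne_query (by simp) _ _ _)
        (restore_zero_step φ (M.step φ x).tape x.head true _ r' _ _))
      rw [if_pos rfl] at h5
      obtain ⟨n, hn, y, hy1, hy2⟩ := tick_outcome (φ := φ) (L := L) (M.step φ x).tape x.head
        M.answer (x.head .query) r' (w - if r < r' then 1 else 0)
        (fun i => c i + if r < r' then r' else 0)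
      refine ⟨_, ?_, y, h5.trans hy1, ?_⟩
      · omega
      · rw [hH, hS]
        rcases hy2 with ⟨hy2, hy3⟩ | hy2
        · exact .inl ⟨hy2, .inr hy3⟩
        · exact .inr ⟨hw', hy2⟩
  · rw [if_neg hq] at hr'
    subst hr'
    rw [run_step φ x hh hq]
    obtain ⟨n, hn, y, hy1, hy2⟩ := tick_outcome (φ := φ) (L := L) (M.step φ x).tape
      (M.step φ x).head (M.step φ x).state ((M.step φ x).head .query) r' w c
    refine ⟨n, by omega, y, hy1, ?_⟩
    simpa using hy2

/-- The ruler starts at 0, so measuring the input counts as a revision: it takes one unit of the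
budget and fills the clock to `(a.length + 2) ^ d - 1`. The tick before the first simulated step
accounts for the second unit in `+ 2`. -/
lemma boot_outcome (a : List Bool) (hd : 0 < d) (hL : 0 < L) :
    ∃ n ≤ L + 4 * (a.length + 1) + 8, ∃ c : Fin d → ℕ,
      (M.clocked d L).Silent φ n ((M.clocked d L).init a)
        (enc (.run M.start) (M.init a).tape (M.init a).head
          (Counter.pack 0 0 (a.length + 1) (L - 1) c)) ∧
      clockValue (a.length + 1) c + 2 = (a.length + 2) ^ d ∧ ∀ i, c i ≤ a.length + 1 := by
  classical
  have h1 := (Silent.single (M := M.clocked d L) (φ := φ) (x := (M.clocked d L).init a)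
    (by simp [init, clocked]) (boot_step φ a)).trans
    (load_loop (φ := φ) (M.init a).tape (M.init a).head 0 0 0 0 L le_rfl 0)
  have h2 := h1.trans (.single (enc_state_ne_query (by simp) _ _ _) (load_zero_step φ _ _ _))
  have h3 := measure (φ := φ) (L := L) (d := d) (M.init a).tape (M.init a).head false a rfl
    0 0 (0 + L) (fun _ => 0) (by omega)
  have hH : Function.update (M.init a).head (srcTape M.Work false) 0 = (M.init a).head :=
    Function.update_eq_self (srcTape M.Work false) (M.init a).head
  rw [hH] at h3
  have h4 := (h2.trans h3).trans (.single (enc_state_ne_query (by simp) _ _ _)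
    (restore_zero_step φ (M.init a).tape (M.init a).head false _ _ _ _))
  simp only [Bool.false_eq_true, if_false, Nat.succ_pos, if_true, zero_add, Nat.zero_max] at h4
  obtain ⟨c, hc1, hc2, hc3⟩ := tick_loop (φ := φ) (L := L) (d := d) (M.init a).tape (M.init a).head
    M.start 0 (a.length + 1) (L - 1) (fun _ => a.length + 1) ⟨⟨0, hd⟩, by omega⟩
  refine ⟨_, ?_, c, h4.trans hc3, ?_, ?_⟩
  · omega
  · have := clockValue_const_add_one d (a.length + 1)
    have h2 : (a.length + 1 + 1) ^ d = (a.length + 2) ^ d := rfl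
    omega
  · simpa using hc2

/-! ### Length revisions -/

open scoped Classical in
lemma lengthRevision_succ (M : OracleMachine) (φ : Baire) (a : List Bool) (n : ℕ)
    (h : (M.config φ a n).state ≠ M.halt) :
    M.lengthRevision φ a (n + 1) + 1 = if (M.config φ a n).state = M.query then
      max (M.lengthRevision φ a n + 1)
        ((φ (readString ((M.config φ a n).tape .query))).length + 1)
      else M.lengthRevision φ a n + 1 := by
  rw [lengthRevision]
  by_cases hq : (M.config φ a n).state = M.query
  · rw [if_pos ⟨h, hq⟩, if_pos hq]; omega
  · rw [if_neg fun h' => hq h'.2, if_neg hq]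

lemma lengthRevision_mono (M : OracleMachine) (φ : Baire) (a : List Bool) :
    Monotone (M.lengthRevision φ a) := by
  refine monotone_nat_of_le_succ fun n => ?_
  conv_rhs => rw [lengthRevision]
  split_ifs
  · exact le_max_left _ _
  · exact le_rfl

/-- The number of values of the length revision function in the first `n` steps. -/
noncomputable def revisionCount (M : OracleMachine) (φ : Baire) (a : List Bool) (n : ℕ) : ℕ :=
  ((Finset.range (n + 1)).image (M.lengthRevision φ a)).card

lemma revisionCount_zero (M : OracleMachine) (φ : Baire) (a : List Bool) :
    M.revisionCount φ a 0 = 1 := by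
  simp [revisionCount]

/-- By monotonicity, a value is new exactly when it exceeds the preceding one. -/
lemma revisionCount_succ (M : OracleMachine) (φ : Baire) (a : List Bool) (n : ℕ) :
    M.revisionCount φ a (n + 1) = M.revisionCount φ a n +
      if M.lengthRevision φ a n < M.lengthRevision φ a (n + 1) then 1 else 0 := by
  unfold revisionCount
  rw [Finset.range_add_one (n := n + 1), Finset.image_insert]
  split_ifs with h
  · rw [Finset.card_insert_of_notMem]
    intro hmem
    obtain ⟨i, hi, hi'⟩ := Finset.mem_image.mp hmem
    have := M.lengthRevision_mono φ a (Nat.lt_succ_iff.mp (Finset.mem_range.mp hi))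
    omega
  · rw [Finset.insert_eq_of_mem, add_zero]
    refine Finset.mem_image.mpr ⟨n, by simp, ?_⟩
    have := M.lengthRevision_mono φ a n.le_succ
    rw [Nat.succ_eq_add_one] at this
    omega

lemma revisionCount_pos (M : OracleMachine) (φ : Baire) (a : List Bool) (n : ℕ) :
    0 < M.revisionCount φ a n := by
  induction n with
  | zero => rw [revisionCount_zero]; exact one_pos
  | succ n ih => rw [revisionCount_succ]; omega

lemma revisionCount_le (M : OracleMachine) {φ : Baire} {a : List Bool} {N : ℕ}
    (h : (Set.range (M.lengthRevision φ a)).encard ≤ N) (n : ℕ) :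
    M.revisionCount φ a n ≤ N := by
  have h' : (((Finset.range (n + 1)).image (M.lengthRevision φ a) : Finset ℕ) : Set ℕ).encard ≤
      (N : ℕ∞) := by
    refine (Set.encard_le_encard ?_).trans h
    rw [Finset.coe_image]
    exact Set.image_subset_range _ _
  rw [Set.encard_coe_eq_coe_finsetCard] at h'
  exact_mod_cast h'

lemma config_succ (M : OracleMachine) (φ : Baire) (a : List Bool) (n : ℕ) :
    M.config φ a (n + 1) = M.step φ (M.config φ a n) :=
  Function.iterate_succ_apply' _ _ _

/-- Bounds the cost of moving the query head to cell 0 and back when step `n` is simulated. -/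
lemma head_config_le (M : OracleMachine) (φ : Baire) (a : List Bool) (n : ℕ)
    (x : TapeName M.Work) : (M.config φ a n).head x ≤ n := by
  induction n with
  | zero => exact le_rfl
  | succ n ih =>
    rw [config_succ]
    unfold step
    split_ifs
    · omega
    · change (M.config φ a n).head x ≤ n + 1
      omega
    · change Move.apply _ ((M.config φ a n).head x) ≤ n + 1
      unfold Move.apply
      split <;> omega

/-! ### The simulation invariant -/

/-- The clocked machine with budget `N + 1` is after `t` steps about to simulate step `k` of `M`,
with `w` length revisions left and with the digits `c` of the clock. -/
structure Tracks (M : OracleMachine) (d N : ℕ) (φ : Baire) (a : List Bool) (k t w : ℕ)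
    (c : Fin d → ℕ) : Prop where
  config_eq : (M.clocked d (N + 1)).config φ a t =
    enc (.run (M.config φ a k).state) (M.config φ a k).tape (M.config φ a k).head
      (Counter.pack ((M.config φ a k).head .query) 0 (M.lengthRevision φ a k + 1) w c)
  length_eq : (M.clocked d (N + 1)).lengthRevision φ a t = M.lengthRevision φ a k
  covered : ∀ j ≤ t, ∃ i ≤ k,
    (M.clocked d (N + 1)).lengthRevision φ a j = M.lengthRevision φ a i
  budget_eq : w + M.revisionCount φ a k = N + 1
  digit_le : ∀ i, c i ≤ M.revisionCount φ a k * (M.lengthRevision φ a k + 1)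
  steps_le : k + clockValue (M.lengthRevision φ a k + 1) c ≤
    M.revisionCount φ a k * (N + 1) * (M.lengthRevision φ a k + 2) ^ d
  le_value : (M.lengthRevision φ a k + 2) ^ d ≤
    clockValue (M.lengthRevision φ a k + 1) c + k + 2
  time_le : t ≤ N + 1 + (k + 1) * (2 * k + 4 * (M.lengthRevision φ a k + 1) + 12)

lemma exists_tracks_zero (M : OracleMachine) {d : ℕ} (hd : 0 < d) (N : ℕ) (φ : Baire)
    (a : List Bool) : ∃ t w c, Tracks M d N φ a 0 t w c := by
  obtain ⟨n, hn, c, h, hv, hc⟩ := boot_outcome (M := M) (φ := φ) a hd (Nat.succ_pos N)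
  have h' : (M.clocked d (N + 1)).Silent φ n ((M.clocked d (N + 1)).config φ a 0) _ := h
  have hlen : ∀ j ≤ n, (M.clocked d (N + 1)).lengthRevision φ a j = M.lengthRevision φ a 0 := by
    intro j hj
    have := h'.lengthRevision_add j hj
    rwa [zero_add] at this
  refine ⟨n, N, c, ?_, hlen n le_rfl, fun j hj => ⟨0, le_rfl, hlen j hj⟩, ?_, ?_, ?_, ?_, ?_⟩
  · have := h'.config_add
    rw [zero_add] at this
    exact this
  · rw [revisionCount_zero]
  · rw [revisionCount_zero]
    simpa [lengthRevision] using hc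
  · rw [revisionCount_zero]
    simp only [lengthRevision, one_mul, zero_add]
    have := Nat.mul_le_mul_right ((a.length + 2) ^ d) (Nat.succ_pos N)
    simp only [Nat.succ_eq_add_one, zero_add, one_mul] at this
    omega
  · simp only [lengthRevision]
    omega
  · simp only [lengthRevision]
    omega

/-- Only the first step of a block can call the oracle, so the length revision takes its new value
at once and keeps it throughout the block. Nothing is assumed about the oracle. -/
lemma Tracks.step {N : ℕ} {a : List Bool} {k t w : ℕ} {c : Fin d → ℕ}
    (h : Tracks M d N φ a k t w c) (hd : 0 < d) (hh : (M.config φ a k).state ≠ M.halt) :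
    ∃ t' > t, (∀ j, t < j → j ≤ t' →
        (M.clocked d (N + 1)).lengthRevision φ a j = M.lengthRevision φ a (k + 1)) ∧
      t' ≤ N + 1 + (k + 2) * (2 * (k + 1) + 4 * (M.lengthRevision φ a (k + 1) + 1) + 12) ∧
      (((M.clocked d (N + 1)).config φ a t').state = (M.clocked d (N + 1)).halt ∧
        ((M.lengthRevision φ a k < M.lengthRevision φ a (k + 1) ∧ w = 0) ∨
          (M.lengthRevision φ a k = M.lengthRevision φ a (k + 1) ∧
            clockValue (M.lengthRevision φ a k + 1) c = 0)) ∨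
        ∃ w' c', Tracks M d N φ a (k + 1) t' w' c') := by
  classical
  have hlen := M.lengthRevision_succ φ a k hh
  have hmono := M.lengthRevision_mono φ a (Nat.le_succ k)
  have hcard := M.revisionCount_succ φ a k
  have hcfg := M.config_succ φ a k
  have htime := h.time_le
  have hsteps := h.steps_le
  have hvalue := h.le_value
  have hdigit := h.digit_le
  have hbudget := h.budget_eq
  have hpos := M.revisionCount_pos φ a k
  generalize hR' : M.lengthRevision φ a (k + 1) = o' at *
  generalize hR : M.lengthRevision φ a k = o at *
  generalize hx : M.config φ a k = x at *
  obtain ⟨n, hn, y, hy, hout⟩ := run_outcome (L := N + 1) (φ := φ) x hh (o + 1) (o' + 1) w c hlen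
  have hcfg1 : (M.clocked d (N + 1)).config φ a (t + 1) = (M.clocked d (N + 1)).step φ
      (enc (.run x.state) x.tape x.head (Counter.pack (x.head .query) 0 (o + 1) w c)) := by
    rw [config_succ, h.config_eq, hx, hR]
  rw [← hcfg1] at hy
  have hlen1 : (M.clocked d (N + 1)).lengthRevision φ a (t + 1) = o' := by
    have hh' : ((M.clocked d (N + 1)).config φ a t).state ≠ (M.clocked d (N + 1)).halt := by
      rw [h.config_eq, hx]
      simpa [enc, clocked] using hh
    have h1 := (M.clocked d (N + 1)).lengthRevision_succ φ a t hh'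
    have hquery : ((M.clocked d (N + 1)).config φ a t).state = (M.clocked d (N + 1)).query ↔
        x.state = M.query := by
      rw [h.config_eq, hx]
      simp [enc, clocked]
    have htape : ((M.clocked d (N + 1)).config φ a t).tape .query = x.tape .query := by
      rw [h.config_eq, hx]
      rfl
    rw [htape, h.length_eq, hR, if_congr hquery rfl rfl] at h1
    have := h1.trans hlen.symm
    omega
  have hlens : ∀ j, t < j → j ≤ t + 1 + n →
      (M.clocked d (N + 1)).lengthRevision φ a j = o' := by
    intro j hj hj'
    obtain ⟨i, rfl⟩ := Nat.exists_eq_add_of_le (Nat.succ_le_of_lt hj)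
    have := hy.lengthRevision_add i (by omega)
    rw [hlen1] at this
    exact this
  have hhead : x.head .query ≤ k := by
    rw [← hx]
    exact M.head_config_le φ a k _
  have htime' : t + 1 + n ≤ N + 1 + (k + 2) * (2 * (k + 1) + 4 * (o' + 1) + 12) := by
    have h1 : (k + 1) * (2 * k + 4 * (o + 1) + 12) ≤
        (k + 1) * (2 * (k + 1) + 4 * (o' + 1) + 12) := Nat.mul_le_mul_left _ (by omega)
    have h2 : (k + 2) * (2 * (k + 1) + 4 * (o' + 1) + 12) =
        (k + 1) * (2 * (k + 1) + 4 * (o' + 1) + 12) + (2 * (k + 1) + 4 * (o' + 1) + 12) := by ring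
    omega
  refine ⟨t + 1 + n, by omega, hlens, htime', ?_⟩
  have hyc := hy.config_add
  rcases hout with ⟨hstate, hcase⟩ | ⟨hw, c', hv, hc', rfl⟩
  · left
    refine ⟨by rw [hyc]; exact hstate, ?_⟩
    rcases hcase with ⟨h1, h2⟩ | h1
    · exact .inl ⟨by omega, h2⟩
    · by_cases hlt : o < o'
      · have := h1 ⟨0, hd⟩
        rw [if_pos (by omega)] at this
        omega
      · exact .inr ⟨by omega, clockValue_eq_zero _ fun i => by have := h1 i; omega⟩
  · right
    have hlt : o + 1 < o' + 1 ↔ o < o' := by omega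
    simp only [hlt] at hyc hv hc' hw
    refine ⟨w - if o < o' then 1 else 0, c', ?_, ?_, ?_, ?_, ?_, ?_, ?_, ?_⟩
    · rw [hyc, hcfg, hR']
    · rw [hR']; exact hlens _ (by omega) le_rfl
    · intro j hj
      by_cases hjt : j ≤ t
      · obtain ⟨i, hi, hi'⟩ := h.covered j hjt
        exact ⟨i, by omega, hi'⟩
      · exact ⟨k + 1, le_rfl, by rw [hR']; exact hlens j (by omega) hj⟩
    · rw [hcard]
      split_ifs with ho
      · have := hw ho; omega
      · omega
    · intro i
      rw [hcard, hR']
      refine (hc' i).trans ?_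
      split_ifs with ho
      · have h1 : M.revisionCount φ a k * (o + 1) ≤ M.revisionCount φ a k * (o' + 1) :=
          Nat.mul_le_mul_left _ (by omega)
        have := hdigit i
        rw [add_mul, one_mul]
        omega
      · have h1 : 1 * (o' + 1) ≤ M.revisionCount φ a k * (o' + 1) :=
          Nat.mul_le_mul_right _ hpos
        have h2 : o = o' := by omega
        subst h2
        have := hdigit i
        simp only [add_zero]
        omega
    · rw [hcard, hR']
      split_ifs at hv ⊢ with ho
      · have hm : M.revisionCount φ a k + 1 ≤ N + 1 := by have := hw ho; omega
        have h1 : clockValue (o' + 1) (fun i => c i + (o' + 1)) ≤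
            (N + 1) * (o' + 2) ^ d := by
          -- Rereading old digits in a larger base raises the value of the clock; the bound on the
          -- single digits keeps this under control.
          have h2 : clockValue (o' + 1) (fun i => c i + (o' + 1)) ≤
              clockValue (o' + 1) (fun _ : Fin d => (N + 1) * (o' + 1)) := by
            refine clockValue_mono _ fun i => ?_
            have h3 : M.revisionCount φ a k * (o + 1) ≤ M.revisionCount φ a k * (o' + 1) :=
              Nat.mul_le_mul_left _ (by omega)
            have h4 := Nat.mul_le_mul_right (o' + 1) hm
            rw [add_mul, one_mul] at h4
            have := hdigit i
            omega
          rw [clockValue_mul (o' + 1) (N + 1) fun _ => o' + 1] at h2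
          refine h2.trans (Nat.mul_le_mul_left _ ?_)
          have := clockValue_const_add_one d (o' + 1)
          rw [← this]
          omega
        have h5 : M.revisionCount φ a k * (N + 1) * (o + 2) ^ d ≤
            M.revisionCount φ a k * (N + 1) * (o' + 2) ^ d :=
          Nat.mul_le_mul_left _ (Nat.pow_le_pow_left (by omega) _)
        have h6 : (M.revisionCount φ a k + 1) * (N + 1) * (o' + 2) ^ d =
          M.revisionCount φ a k * (N + 1) * (o' + 2) ^ d + (N + 1) * (o' + 2) ^ d := by ring
        omega
      · have h2 : o = o' := by omega
        subst h2
        simp only [add_zero] at hv ⊢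
        change _ = clockValue (o + 1) c at hv
        omega
    · rw [hR']
      split_ifs at hv with ho
      · have h1 := clockValue_mono (o' + 1) (c := fun _ => o' + 1)
          (c' := fun i => c i + (o' + 1)) fun i => by omega
        have := clockValue_const_add_one d (o' + 1)
        have h2 : (o' + 1 + 1) ^ d = (o' + 2) ^ d := rfl
        omega
      · have h2 : o = o' := by omega
        subst h2
        simp only [add_zero] at hv
        change _ = clockValue (o + 1) c at hv
        omega
    · rw [hR']
      exact htime'

/-! ### Halting -/

lemma config_eq_of_halt {a : List Bool} {m n : ℕ} (h : (M.config φ a m).state = M.halt)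
    (hmn : m ≤ n) : M.config φ a n = M.config φ a m := by
  induction n, hmn using Nat.le_induction with
  | base => rfl
  | succ n _ ih =>
    rw [config_succ, ih]
    unfold step
    rw [if_pos h]

lemma le_time_iff {a : List Bool} {n : ℕ} :
    (n : ℕ∞) ≤ M.time φ a ↔ ∀ j < n, (M.config φ a j).state ≠ M.halt := by
  unfold time
  rw [le_iInf₂_iff]
  refine forall_congr' fun j => ?_
  rw [Nat.cast_le, ← not_lt]
  tauto

/-- Finitely many length revision values leave only finitely many values of the polynomial, so the
running time is bounded. -/
lemma exists_halt {A : Set Baire} (h : M.RunsInStronglyPolyTimeOn A) (hφ : φ ∈ A)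
    (a : List Bool) : ∃ n, (M.config φ a n).state = M.halt := by
  obtain ⟨⟨N, hN⟩, p, hp⟩ := h
  by_contra! hne
  have hfin : (Set.range (M.lengthRevision φ a)).Finite :=
    Set.finite_of_encard_le_coe (hN φ hφ a)
  obtain ⟨B, hB⟩ := (hfin.image fun m => p.eval m).bddAbove
  have h1 := hp φ hφ a (B + 1) (le_time_iff.mpr fun j _ => hne j)
  have h2 := hB (Set.mem_image_of_mem _ (Set.mem_range_self (B + 1)))
  exact absurd (h1.trans h2) (by omega)

/-- Any `B + 1` values would already be attained within finitely many steps. -/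
lemma encard_range_le {a : List Bool} {B : ℕ} (h : ∀ n, M.revisionCount φ a n ≤ B) :
    (Set.range (M.lengthRevision φ a)).encard ≤ B := by
  by_contra! hlt
  have hle : ((B + 1 : ℕ) : ℕ∞) ≤ (Set.range (M.lengthRevision φ a)).encard := by
    rw [Nat.cast_add, Nat.cast_one]
    exact Order.add_one_le_of_lt hlt
  obtain ⟨s, hs, hcard⟩ := Set.exists_subset_encard_eq hle
  have hfin : s.Finite := Set.finite_of_encard_le_coe hcard.le
  choose! f hf using fun x (hx : x ∈ s) => hs hx
  obtain ⟨n, hn⟩ := (hfin.image f).bddAbove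
  have hsub : s ⊆ ((Finset.range (n + 1)).image (M.lengthRevision φ a) : Finset ℕ) := by
    intro x hx
    rw [Finset.mem_coe, Finset.mem_image]
    exact ⟨f x, Finset.mem_range_succ_iff.mpr (hn (Set.mem_image_of_mem f hx)), hf x hx⟩
  have h1 := Set.encard_le_encard hsub
  rw [Set.encard_coe_eq_coe_finsetCard, hcard, Nat.cast_le] at h1
  exact absurd (h1.trans (h n)) (by omega)

/-! ### The clocked machine runs in strongly polynomial time -/

/-- Bounds for the clocked machine after `t` steps, when it has simulated `k` steps of `M`. -/
structure Bounded (M : OracleMachine) (d N : ℕ) (φ : Baire) (a : List Bool) (k t : ℕ) : Prop where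
  length_eq : (M.clocked d (N + 1)).lengthRevision φ a t = M.lengthRevision φ a k
  covered : ∀ j ≤ t, ∃ i ≤ k,
    (M.clocked d (N + 1)).lengthRevision φ a j = M.lengthRevision φ a i
  count_le : M.revisionCount φ a k ≤ N + 2
  steps_le : k ≤ (N + 1) * (N + 1) * (M.lengthRevision φ a k + 2) ^ d + 1
  time_le : t ≤ N + 1 + (k + 1) * (2 * k + 4 * (M.lengthRevision φ a k + 1) + 12)

lemma Tracks.steps_le' {N : ℕ} {a : List Bool} {k t w : ℕ} {c : Fin d → ℕ}
    (h : Tracks M d N φ a k t w c) :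
    k ≤ (N + 1) * (N + 1) * (M.lengthRevision φ a k + 2) ^ d := by
  have h1 := h.steps_le
  have h2 : M.revisionCount φ a k ≤ N + 1 := by have := h.budget_eq; omega
  have h3 := Nat.mul_le_mul_right ((M.lengthRevision φ a k + 2) ^ d)
    (Nat.mul_le_mul_right (N + 1) h2)
  omega

lemma Tracks.bounded {N : ℕ} {a : List Bool} {k t w : ℕ} {c : Fin d → ℕ}
    (h : Tracks M d N φ a k t w c) : Bounded M d N φ a k t :=
  ⟨h.length_eq, h.covered, by have := h.budget_eq; omega, h.steps_le'.trans (Nat.le_succ _),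
    h.time_le⟩

/-- A time `n` inside a block is bounded by the end `t` of that block, where the length revision is
still the same. This makes the time bound hold in terms of the current length and not only the final
one. -/
lemma exists_bounded (hd : 0 < d) (N : ℕ) (φ : Baire) (a : List Bool) (n : ℕ)
    (hn : (n : ℕ∞) ≤ (M.clocked d (N + 1)).time φ a) :
    ∃ t ≥ n, (M.clocked d (N + 1)).lengthRevision φ a n =
        (M.clocked d (N + 1)).lengthRevision φ a t ∧
      ∃ k, Bounded M d N φ a k t ∧
        (((M.clocked d (N + 1)).config φ a t).state = (M.clocked d (N + 1)).halt ∨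
          ∃ w c, Tracks M d N φ a k t w c) := by
  induction n with
  | zero =>
    obtain ⟨t, w, c, h⟩ := exists_tracks_zero M hd N φ a
    refine ⟨t, Nat.zero_le _, ?_, 0, h.bounded, .inr ⟨w, c, h⟩⟩
    rw [h.length_eq]
    rfl
  | succ n ih =>
    rw [le_time_iff] at hn
    obtain ⟨t, htn, hlen, k, hb, hcase⟩ := ih (le_time_iff.mpr fun j hj => hn j (by omega))
    rcases eq_or_lt_of_le htn with rfl | hlt
    · have hnh := hn n (Nat.lt_succ_self n)
      obtain ⟨w, c, h⟩ := hcase.resolve_left hnh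
      have hh : (M.config φ a k).state ≠ M.halt := by
        intro hh
        refine hnh ?_
        rw [h.config_eq, hh]
        rfl
      obtain ⟨t', ht', hlen', htime, hcase'⟩ := h.step hd hh
      refine ⟨t', ht', ?_, k + 1, ?_, ?_⟩
      · rw [hlen' _ (Nat.lt_succ_self n) ht', hlen' _ ht' le_rfl]
      · refine ⟨hlen' _ ht' le_rfl, fun j hj => ?_, ?_, ?_, htime⟩
        · by_cases hjn : j ≤ n
          · obtain ⟨i, hi, hi'⟩ := h.covered j hjn
            exact ⟨i, by omega, hi'⟩
          · exact ⟨k + 1, le_rfl, hlen' j (by omega) hj⟩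
        · have := h.budget_eq
          rw [revisionCount_succ]
          split_ifs <;> omega
        · have h1 : (M.lengthRevision φ a k + 2) ^ d ≤ (M.lengthRevision φ a (k + 1) + 2) ^ d :=
            Nat.pow_le_pow_left (Nat.add_le_add_right (M.lengthRevision_mono φ a k.le_succ) 2) d
          exact Nat.succ_le_succ (h.steps_le'.trans (Nat.mul_le_mul_left _ h1))
      · rcases hcase' with hcase' | ⟨w', c', hcase'⟩
        · exact .inl hcase'.1
        · exact .inr ⟨w', c', hcase'⟩
    · refine ⟨t, hlt, ?_, k, hb, hcase⟩
      have h1 := (M.clocked d (N + 1)).lengthRevision_mono φ a n.le_succ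
      have h2 := (M.clocked d (N + 1)).lengthRevision_mono φ a hlt
      rw [Nat.succ_eq_add_one] at h1 h2
      omega

/-- `N + 1` values fit into the budget; one more is the oracle answer that makes the machine stop.
-/
lemma clocked_revisionCount_le (hd : 0 < d) (N : ℕ) (φ : Baire) (a : List Bool) (n : ℕ) :
    (M.clocked d (N + 1)).revisionCount φ a n ≤ N + 2 := by
  induction n with
  | zero => rw [revisionCount_zero]; omega
  | succ n ih =>
    by_cases hn : ((n + 1 : ℕ) : ℕ∞) ≤ (M.clocked d (N + 1)).time φ a
    · obtain ⟨t, htn, -, k, hb, -⟩ := exists_bounded hd N φ a (n + 1) hn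
      refine le_trans (Finset.card_le_card ?_) hb.count_le
      intro x hx
      obtain ⟨j, hj, rfl⟩ := Finset.mem_image.mp hx
      obtain ⟨i, hi, hi'⟩ := hb.covered j ((Finset.mem_range_succ_iff.mp hj).trans htn)
      exact Finset.mem_image.mpr ⟨i, Finset.mem_range_succ_iff.mpr hi, hi'.symm⟩
    · have hh : ((M.clocked d (N + 1)).config φ a n).state = (M.clocked d (N + 1)).halt := by
        rw [le_time_iff] at hn
        push Not at hn
        obtain ⟨j, hj, hj'⟩ := hn
        rw [config_eq_of_halt hj' (Nat.lt_succ_iff.mp hj), hj']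
      have heq : (M.clocked d (N + 1)).lengthRevision φ a (n + 1) =
          (M.clocked d (N + 1)).lengthRevision φ a n := by
        rw [lengthRevision, if_neg fun h => h.1 hh]
      rwa [revisionCount_succ, heq, if_neg (lt_irrefl _), add_zero]

theorem clocked_runsInStronglyPolyTimeOn_univ (M : OracleMachine) (hd : 0 < d) (N : ℕ) :
    (M.clocked d (N + 1)).RunsInStronglyPolyTimeOn Set.univ := by
  refine ⟨⟨N + 2, fun φ _ a => encard_range_le (clocked_revisionCount_le hd N φ a)⟩, ?_⟩
  -- The summand 1 in `K` allows for the last block, in which the simulation is stopped.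
  let K : Polynomial ℕ := Polynomial.C ((N + 1) * (N + 1)) * (Polynomial.X + 2) ^ d + 1
  refine ⟨Polynomial.C (N + 1) + (K + 1) * (2 * K + 4 * (Polynomial.X + 1) + 12),
    fun φ _ a n hn => ?_⟩
  obtain ⟨t, htn, hlen, k, hb, -⟩ := exists_bounded hd N φ a n hn
  rw [hlen, hb.length_eq]
  refine (htn.le.trans hb.time_le).trans ?_
  have hk := hb.steps_le
  generalize M.lengthRevision φ a k = o at *
  have hK : K.eval o = (N + 1) * (N + 1) * (o + 2) ^ d + 1 := by simp [K]
  rw [← hK] at hk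
  simp only [Polynomial.eval_add, Polynomial.eval_mul, Polynomial.eval_C, Polynomial.eval_X,
    Polynomial.eval_one, Polynomial.eval_ofNat]
  gcongr

/-! ### The clocked machine computes the same functional -/

lemma exists_tracks (hd : 0 < d) {N : ℕ} {a : List Bool}
    (hN : (Set.range (M.lengthRevision φ a)).encard ≤ N) {p : ℕ → ℕ}
    (hp : ∀ n : ℕ, (n : ℕ∞) ≤ M.time φ a → n ≤ p (M.lengthRevision φ a n))
    (hpd : ∀ m, p m + 3 ≤ (m + 2) ^ d) (k : ℕ) (hk : (k : ℕ∞) ≤ M.time φ a) :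
    ∃ t w c, Tracks M d N φ a k t w c := by
  induction k with
  | zero => exact exists_tracks_zero M hd N φ a
  | succ k ih =>
    have hk' := le_time_iff.mp hk
    obtain ⟨t, w, c, h⟩ := ih (le_time_iff.mpr fun j hj => hk' j (by omega))
    obtain ⟨t', -, -, -, hcase⟩ := h.step hd (hk' k (Nat.lt_succ_self k))
    rcases hcase with ⟨-, ⟨hlt, rfl⟩ | ⟨heq, hzero⟩⟩ | hcase
    -- An exhausted budget means `N + 1` values so far, more than `M` has on this oracle.
    · have h1 := M.revisionCount_le hN (k + 1)
      have h2 := h.budget_eq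
      rw [revisionCount_succ, if_pos hlt] at h1
      omega
    -- An empty clock gives `(o + 2) ^ d ≤ k + 2` for the current length `o`, whereas `k + 1 ≤ p o`
    -- because step `k + 1` is within the running time.
    · have h1 := h.le_value
      have h2 := hp _ hk
      have h3 := hpd (M.lengthRevision φ a k)
      rw [← heq] at h2
      omega
    · exact ⟨t', hcase⟩

lemma clocked_returns (hd : 0 < d) {N : ℕ} {a w : List Bool}
    (hN : (Set.range (M.lengthRevision φ a)).encard ≤ N) {p : ℕ → ℕ}
    (hp : ∀ n : ℕ, (n : ℕ∞) ≤ M.time φ a → n ≤ p (M.lengthRevision φ a n))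
    (hpd : ∀ m, p m + 3 ≤ (m + 2) ^ d) (hw : M.Returns φ a w) :
    (M.clocked d (N + 1)).Returns φ a w := by
  classical
  obtain ⟨n, hn, rfl⟩ := hw
  have hex : ∃ n, (M.config φ a n).state = M.halt := ⟨n, hn⟩
  -- Tracking reaches only up to the running time, so the first halting time is used; the
  -- configuration is constant from there on.
  obtain ⟨t, b, c, h⟩ := exists_tracks hd hN hp hpd (Nat.find hex)
    (le_time_iff.mpr fun j hj => Nat.find_min hex hj)
  have hh := Nat.find_spec hex
  refine ⟨t, ?_, ?_⟩
  · rw [h.config_eq, hh]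
    rfl
  · rw [h.config_eq, config_eq_of_halt hh (Nat.find_min' hex hn)]
    rfl

/-- With base at least 2, a coefficient `c` is absorbed by `2 ^ c`, and the sum of two powers by one
further factor. -/
lemma exists_pow_bound (p : Polynomial ℕ) : ∃ d, ∀ m, p.eval m ≤ (m + 2) ^ d := by
  induction p using Polynomial.induction_on' with
  | add p q hp hq =>
    obtain ⟨d, hd⟩ := hp
    obtain ⟨e, he⟩ := hq
    refine ⟨d + e + 1, fun m => ?_⟩
    have h1 : (m + 2) ^ d ≤ (m + 2) ^ (d + e) := Nat.pow_le_pow_right (by omega) (by omega)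
    have h2 : (m + 2) ^ e ≤ (m + 2) ^ (d + e) := Nat.pow_le_pow_right (by omega) (by omega)
    have h3 : (m + 2) ^ (d + e) * 2 ≤ (m + 2) ^ (d + e) * (m + 2) :=
      Nat.mul_le_mul_left _ (by omega)
    have := hd m
    have := he m
    rw [Polynomial.eval_add, pow_succ]
    omega
  | monomial n c =>
    refine ⟨c + n, fun m => ?_⟩
    rw [Polynomial.eval_monomial, pow_add]
    refine Nat.mul_le_mul ?_ (Nat.pow_le_pow_left (by omega) _)
    exact (Nat.lt_two_pow_self).le.trans (Nat.pow_le_pow_left (by omega) _)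

theorem exists_clocked {A : Set Baire} {F : A → Baire} (hF : M.Computes F)
    (h : M.RunsInStronglyPolyTimeOn A) :
    ∃ M' : OracleMachine, M'.Computes F ∧ M'.RunsInStronglyPolyTimeOn Set.univ := by
  obtain ⟨⟨N, hN⟩, p, hp⟩ := h
  obtain ⟨d, hpd⟩ := exists_pow_bound (p + Polynomial.C 3)
  simp only [Polynomial.eval_add, Polynomial.eval_C] at hpd
  have hd : 0 < d := by
    rcases Nat.eq_zero_or_pos d with rfl | hd
    · have := hpd 0
      rw [pow_zero] at this
      omega
    · exact hd
  exact ⟨M.clocked d (N + 1), fun φ a => clocked_returns hd (hN φ φ.2 a) (hp φ φ.2 a) hpd (hF φ a),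
    clocked_runsInStronglyPolyTimeOn_univ M hd N⟩

end OracleMachine

theorem mainTheorem5 (A : Set Baire) : SPRestricted A = SPExtendable A := by
  classical
  ext F
  constructor
  · rintro ⟨M, hF, hM⟩
    obtain ⟨M', hF', hM'⟩ := OracleMachine.exists_clocked hF hM
    have hret : ∀ φ a, ∃ w, M'.Returns φ a w := fun φ a => by
      obtain ⟨n, hn⟩ := OracleMachine.exists_halt hM' (Set.mem_univ φ) a
      exact ⟨_, n, hn, rfl⟩
    choose G hG using hret
    -- Taking `F` itself on `A` makes the extension property immediate, without an argument that
    -- returned values are unique.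
    refine ⟨fun φ a => if h : φ ∈ A then F ⟨φ, h⟩ a else G φ a, ⟨M', fun φ a => ?_, hM'⟩,
      fun φ => ?_⟩
    · dsimp only
      split_ifs with h
      · exact hF' ⟨φ, h⟩ a
      · exact hG φ a
    · funext a
      simp
  · rintro ⟨G, ⟨M, hG, ⟨N, hN⟩, p, hp⟩, hGF⟩
    refine ⟨M, fun φ a => ?_, ⟨N, fun φ _ => hN φ trivial⟩, p, fun φ _ => hp φ trivial⟩
    rw [← hGF φ]
    exact hG φ a
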